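/- Let $(F,g_F)$ be a finite-dimensional smooth Riemannian manifold without boundary, let $f\colon F\to(0,\infty)$ be smooth, and let $I=(t_1,t_2)\subseteq\mathbb R$ with $-\infty\le t_1<t_2\le\infty$. Let $M=I\times F$ carry the metric $g=-f^2\,\mathrm dt^2\oplus g_F$ (a standard static space-time). Let $\mathrm{Ric}$ and $\tau$ be the Ricci tensor and scalar curvature of $g$, and let $T$ be the energy-momentum tensor on $M$ defined by Einstein's equation $\mathrm{Ric}-\tfrac12\tau g=8\pi T$. Let $\mathrm{Ric}_{g_F}$ and $\tau_{g_F}$ be the Ricci tensor and scalar curvature of $g_F$, let $H^f_{g_F}$ be the Hessian tensor of $f$ and $\Delta_{g_F}f$ its $g_F$-trace, put $$\mathscr L^*_{g_F}f:=-f\,\mathrm{Ric}_{g_F}-(\Delta_{g_F}f)\,g_F+H^f_{g_F},$$ and let $\mathcal L^*_{g_F}f(v):=\mathscr L^*_{g_F}f(v,v)$ be the associated quadratic form. A tangent vector $w\in TM$ is causal if $w\ne0$ and $g(w,w)\le0$. 1. If $\mathcal L^*_{g_F}f$ is negative (respectively, positive) semi-definite at every point of $F$ and $\tau_{g_F}\ge0$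 (respectively, $\tau_{g_F}\le0$) on $F$, then $T(w,w)\ge0$ (respectively, $T(w,w)\le0$) for every causal vector $w\in TM$. 2. If $\mathcal L^*_{g_F}f\equiv0$, then $8\pi T(w,w)=-\tfrac12\,\tau_{g_F}\,g(w,w)$ for every $w\in TM$ (with $\tau_{g_F}$ evaluated at the projection to $F$ of the base point of $w$). Consequently, in that case, $T(w,w)\ge0$ for every causal vector $w\in TM$ if and only if $\tau_{g_F}\ge0$ on $F$. -/

import Mathlib

open scoped Manifold ContDiff

set_option maxSynthPendingDepth 3

noncomputable section

namespace PseudoRiem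

section Pullback

variable {V W : Type*} [TopologicalSpace V] [AddCommGroup V] [Module ℝ V]
  [TopologicalSpace W] [AddCommGroup W] [Module ℝ W]

/-- The pullback `(u, v) ↦ B(A u, A v)` of a bilinear form under a linear map. -/
def pullback (B : W →L[ℝ] W →L[ℝ] ℝ) (A : V →L[ℝ] W) : V →L[ℝ] V →L[ℝ] ℝ :=
  (ContinuousLinearMap.precomp ℝ A).comp (B.comp A)

theorem pullback_apply (B : W →L[ℝ] W →L[ℝ] ℝ) (A : V →L[ℝ] W) (u v : V) :
    pullback B A u v = B (A u) (A v) := rfl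

end Pullback

/-! ### Local formulas

`G : E → E →L[ℝ] E →L[ℝ] ℝ` is the coordinate expression of a pseudo-Riemannian metric on an open
subset of the finite-dimensional vector space `E`; the formulas are basis-free. -/

section Local

variable {E : Type*} [NormedAddCommGroup E] [NormedSpace ℝ E]

/-- The Koszul expression
`K(u, v, w) = (D_u G)(v, w) + (D_v G)(u, w) - (D_w G)(u, v)` for constant fields `u, v, w`. -/
def koszul (G : E → E →L[ℝ] E →L[ℝ] ℝ) (x : E) : E →L[ℝ] E →L[ℝ] E →L[ℝ] ℝ :=
  fderiv ℝ G x + (fderiv ℝ G x).flip -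
    ((ContinuousLinearMap.flipₗᵢ ℝ E E ℝ).toContinuousLinearEquiv :
      (E →L[ℝ] E →L[ℝ] ℝ) →L[ℝ] (E →L[ℝ] E →L[ℝ] ℝ)).comp (fderiv ℝ G x).flip

theorem koszul_apply (G : E → E →L[ℝ] E →L[ℝ] ℝ) (x u v w : E) :
    koszul G x u v w
      = fderiv ℝ G x u v w + fderiv ℝ G x v u w - fderiv ℝ G x w u v := rfl

/-- The Christoffel symbol of the Levi-Civita connection: `Γ(u, v) = ∇_u v` for constant fields,
that is, `2 G(Γ(u, v), w) = K(u, v, w)` for all `w`. -/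
def christoffel (G : E → E →L[ℝ] E →L[ℝ] ℝ) (x : E) : E →L[ℝ] E →L[ℝ] E :=
  (1 / 2 : ℝ) • (ContinuousLinearMap.compL ℝ E (E →L[ℝ] ℝ) E (G x).inverse).comp (koszul G x)

theorem christoffel_apply (G : E → E →L[ℝ] E →L[ℝ] ℝ) (x u v : E) :
    christoffel G x u v = (1 / 2 : ℝ) • (G x).inverse (koszul G x u v) := rfl

/-- The endomorphism `u ↦ R(u, v) w` of the Riemann curvature operator
`R(u, v) w = ∇_u ∇_v w - ∇_v ∇_u w - ∇_[u, v] w`. -/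
def curvatureEndo (G : E → E →L[ℝ] E →L[ℝ] ℝ) (x v w : E) : E →L[ℝ] E :=
  ((fderiv ℝ (christoffel G) x).flip v).flip w - (fderiv ℝ (christoffel G) x v).flip w
    + (christoffel G x).flip (christoffel G x v w)
    - (christoffel G x v).comp ((christoffel G x).flip w)

theorem curvatureEndo_apply (G : E → E →L[ℝ] E →L[ℝ] ℝ) (x u v w : E) :
    curvatureEndo G x v w u
      = fderiv ℝ (christoffel G) x u v w - fderiv ℝ (christoffel G) x v u w
        + christoffel G x u (christoffel G x v w) - christoffel G x v (christoffel G x u w) := rfl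

/-- The Ricci tensor in coordinates: `Ric(v, w)` is the trace of `u ↦ R(u, v) w`. -/
def localRicci [FiniteDimensional ℝ E] (G : E → E →L[ℝ] E →L[ℝ] ℝ) (x : E) :
    E →L[ℝ] E →L[ℝ] ℝ :=
  LinearMap.toContinuousBilinearMap <|
    LinearMap.mk₂ ℝ (fun v w => LinearMap.trace ℝ E (curvatureEndo G x v w : E →ₗ[ℝ] E))
      (fun v v' w => by
        rw [← map_add]; congr 1; ext u
        simp [curvatureEndo_apply]; abel)
      (fun c v w => by
        rw [← map_smul]; congr 1; ext u
        simp [curvatureEndo_apply, smul_sub, smul_add])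
      (fun v w w' => by
        rw [← map_add]; congr 1; ext u
        simp [curvatureEndo_apply]; abel)
      (fun c v w => by
        rw [← map_smul]; congr 1; ext u
        simp [curvatureEndo_apply, smul_sub, smul_add])

theorem localRicci_apply [FiniteDimensional ℝ E] (G : E → E →L[ℝ] E →L[ℝ] ℝ) (x v w : E) :
    localRicci G x v w = LinearMap.trace ℝ E (curvatureEndo G x v w : E →ₗ[ℝ] E) := rfl

/-- The Hessian in coordinates: `(∇ dh)(u, v) = D²h(u, v) - Dh(Γ(u, v))`. -/
def localHessian (G : E → E →L[ℝ] E →L[ℝ] ℝ) (h : E → ℝ) (x : E) : E →L[ℝ] E →L[ℝ] ℝ :=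
  fderiv ℝ (fderiv ℝ h) x
    - (ContinuousLinearMap.compL ℝ E E ℝ (fderiv ℝ h x)).comp (christoffel G x)

theorem localHessian_apply (G : E → E →L[ℝ] E →L[ℝ] ℝ) (h : E → ℝ) (x u v : E) :
    localHessian G h x u v
      = fderiv ℝ (fderiv ℝ h) x u v - fderiv ℝ h x (christoffel G x u v) := rfl

end Local

/-! ### Tensors on a manifold without boundary -/

section Global

variable {E : Type*} [NormedAddCommGroup E] [NormedSpace ℝ E]
  {H : Type*} [TopologicalSpace H] (I : ModelWithCorners ℝ E H)
  {M : Type*} [TopologicalSpace M] [ChartedSpace H M]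

/-- The `g`-trace of a bilinear form `β` on the tangent space at `p`: the trace of the
endomorphism obtained from `β` by raising an index with `g`. -/
def traceAt (g : ∀ p : M, TangentSpace I p →L[ℝ] TangentSpace I p →L[ℝ] ℝ) (p : M)
    (β : TangentSpace I p →L[ℝ] TangentSpace I p →L[ℝ] ℝ) : ℝ :=
  LinearMap.trace ℝ (TangentSpace I p)
    ((g p).inverse.comp β : TangentSpace I p →L[ℝ] TangentSpace I p)

/-- The metric `g` in the chart `φ` at `p`: the pullback of `g` under `φ⁻¹`, a field of bilinear
forms on the model space. (For the models without boundary used here, `Set.range I` is the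
whole space.) -/
def inChart (g : ∀ p : M, TangentSpace I p →L[ℝ] TangentSpace I p →L[ℝ] ℝ) (p : M) (y : E) :
    E →L[ℝ] E →L[ℝ] ℝ :=
  pullback (g ((extChartAt I p).symm y))
    (mfderivWithin 𝓘(ℝ, E) I (extChartAt I p).symm (Set.range I) y)

/-- The Ricci tensor of `g`, computed at `p` in the chart at `p`
and pulled back to the tangent space at `p` by the derivative of the chart. -/
def ricci [FiniteDimensional ℝ E]
    (g : ∀ p : M, TangentSpace I p →L[ℝ] TangentSpace I p →L[ℝ] ℝ) (p : M) :
    TangentSpace I p →L[ℝ] TangentSpace I p →L[ℝ] ℝ :=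
  pullback (localRicci (inChart I g p) (extChartAt I p p))
    (mfderiv I 𝓘(ℝ, E) (extChartAt I p) p)

/-- The scalar curvature: the `g`-trace of the Ricci tensor. -/
def scalarCurvature [FiniteDimensional ℝ E]
    (g : ∀ p : M, TangentSpace I p →L[ℝ] TangentSpace I p →L[ℝ] ℝ) (p : M) : ℝ :=
  traceAt I g p (ricci I g p)

/-- The Hessian tensor of the function `f` with respect to `g`. -/
def hessian (g : ∀ p : M, TangentSpace I p →L[ℝ] TangentSpace I p →L[ℝ] ℝ) (f : M → ℝ) (p : M) :
    TangentSpace I p →L[ℝ] TangentSpace I p →L[ℝ] ℝ :=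
  pullback (localHessian (inChart I g p) (f ∘ (extChartAt I p).symm) (extChartAt I p p))
    (mfderiv I 𝓘(ℝ, E) (extChartAt I p) p)

/-- The Laplace-Beltrami operator: the `g`-trace of the Hessian. -/
def laplacian (g : ∀ p : M, TangentSpace I p →L[ℝ] TangentSpace I p →L[ℝ] ℝ) (f : M → ℝ) (p : M) :
    ℝ :=
  traceAt I g p (hessian I g f p)

/-- The tensor `ℒ*_g f = -f Ric_g - (Δ_g f) g + Hess_g f`. -/
def adjointScalar [FiniteDimensional ℝ E]
    (g : ∀ p : M, TangentSpace I p →L[ℝ] TangentSpace I p →L[ℝ] ℝ) (f : M → ℝ) (p : M) :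
    TangentSpace I p →L[ℝ] TangentSpace I p →L[ℝ] ℝ :=
  -(f p • ricci I g p) - laplacian I g f p • g p + hessian I g f p

/-- The energy-momentum tensor `T` given by Einstein's equation `Ric - (1/2) τ g = 8 π T`. -/
def energyMomentum [FiniteDimensional ℝ E]
    (g : ∀ p : M, TangentSpace I p →L[ℝ] TangentSpace I p →L[ℝ] ℝ) (p : M) :
    TangentSpace I p →L[ℝ] TangentSpace I p →L[ℝ] ℝ :=
  (1 / (8 * Real.pi)) • (ricci I g p - (1 / 2 * scalarCurvature I g p) • g p)

/-- A tangent vector is causal if it is nonzero and timelike or null. -/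
def IsCausal (g : ∀ p : M, TangentSpace I p →L[ℝ] TangentSpace I p →L[ℝ] ℝ) (p : M)
    (w : TangentSpace I p) : Prop :=
  w ≠ 0 ∧ g p w w ≤ 0

end Global

/-! ### Standard static space-times -/

/-- The open interval `(t₁, t₂)` of real numbers, with possibly infinite end points. -/
def openInterval (t₁ t₂ : EReal) : TopologicalSpace.Opens ℝ where
  carrier := {t : ℝ | t₁ < (t : EReal) ∧ (t : EReal) < t₂}
  is_open' :=
    (isOpen_lt continuous_const continuous_coe_real_ereal).inter
      (isOpen_lt continuous_coe_real_ereal continuous_const)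

section Static

variable {E : Type*} [NormedAddCommGroup E] [NormedSpace ℝ E]
  {F : Type*} [TopologicalSpace F] [ChartedSpace E F]

/-- The differential at `x` of the projection `I × F → I ⊆ ℝ`, i.e. the one-form `dt`. -/
def dt (J : TopologicalSpace.Opens ℝ) (x : J × F) :
    TangentSpace (𝓘(ℝ, ℝ).prod 𝓘(ℝ, E)) x →L[ℝ] ℝ :=
  mfderiv (𝓘(ℝ, ℝ).prod 𝓘(ℝ, E)) 𝓘(ℝ, ℝ) (fun y : J × F => (y.1 : ℝ)) x

/-- The metric `-f² dt² ⊕ g_F` on the product of an open subset of the line with `F`; the second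
summand is the pullback of `g_F` by the projection to `F`. -/
def staticMetric (J : TopologicalSpace.Opens ℝ) (f : F → ℝ)
    (gF : ∀ p : F, TangentSpace 𝓘(ℝ, E) p →L[ℝ] TangentSpace 𝓘(ℝ, E) p →L[ℝ] ℝ) (x : J × F) :
    TangentSpace (𝓘(ℝ, ℝ).prod 𝓘(ℝ, E)) x →L[ℝ]
      TangentSpace (𝓘(ℝ, ℝ).prod 𝓘(ℝ, E)) x →L[ℝ] ℝ :=
  -(f x.2 ^ 2 • pullback (ContinuousLinearMap.mul ℝ ℝ) (dt J x))
    + pullback (gF x.2)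
      (mfderiv (𝓘(ℝ, ℝ).prod 𝓘(ℝ, E)) 𝓘(ℝ, E) (Prod.snd : J × F → F) x)

end Static

end PseudoRiem

end

/-!
The chart of `I × F` at a point is the product of the charts of the factors, and in it the metric is
block diagonal, `-φ² dt² ⊕ γ`, with `φ` and `γ` independent of `t`. Its Christoffel symbol is that
of `γ` corrected by `d log φ` and by the acceleration `∇_∂t ∂t = φ grad φ`. Differentiating these
and taking traces block by block gives
`Ric = (φ Δφ) dt² ⊕ (Ric_γ - φ⁻¹ Hess φ)` and `τ = τ_γ - 2 Δφ / φ`, so the `Δφ` terms of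
`Ric - (1/2) τ g` cancel in the time direction and complete `ℒ*` in the space directions:
`8 π T = -φ⁻¹ ℒ* φ - (1/2) τ_γ g`.
On causal vectors both summands have the sign prescribed by the hypotheses. Conversely `ℒ*` does not
see `∂_t`, so `8 π T(∂_t, ∂_t) = (1/2) τ_γ φ²` recovers the sign of `τ_γ`.
-/

noncomputable section

namespace PseudoRiem

section BlockTrace

variable {R M N : Type*} [CommRing R] [AddCommGroup M] [Module R M] [Module.Free R M]
  [Module.Finite R M] [AddCommGroup N] [Module R N] [Module.Free R N] [Module.Finite R N]

theorem trace_prod_eq_add (A : (M × N) →ₗ[R] M × N) :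
    LinearMap.trace R (M × N) A
      = LinearMap.trace R M (LinearMap.fst R M N ∘ₗ A ∘ₗ LinearMap.inl R M N)
        + LinearMap.trace R N (LinearMap.snd R M N ∘ₗ A ∘ₗ LinearMap.inr R M N) := by
  have hA : A = (A ∘ₗ LinearMap.inl R M N) ∘ₗ LinearMap.fst R M N
      + (A ∘ₗ LinearMap.inr R M N) ∘ₗ LinearMap.snd R M N := by
    rw [LinearMap.comp_assoc, LinearMap.comp_assoc, ← LinearMap.comp_add]
    ext <;> simp
  conv_lhs => rw [hA]
  rw [map_add, LinearMap.trace_comp_comm', LinearMap.trace_comp_comm' _ (LinearMap.snd R M N)]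

theorem trace_ring_eq_apply_one (L : R →ₗ[R] R) : LinearMap.trace R R L = L 1 := by
  rw [LinearMap.trace_eq_matrix_trace R (Module.Basis.singleton Unit R)]
  simp [Matrix.trace, LinearMap.toMatrix_apply]

theorem trace_ring_prod (A : (R × N) →ₗ[R] R × N) :
    LinearMap.trace R (R × N) A
      = (A (1, 0)).1 + LinearMap.trace R N (LinearMap.snd R R N ∘ₗ A ∘ₗ LinearMap.inr R R N) := by
  rw [trace_prod_eq_add, trace_ring_eq_apply_one]
  rfl

end BlockTrace

section MetricTrace

variable {E : Type*} [NormedAddCommGroup E] [NormedSpace ℝ E]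

/-- The trace of a bilinear form `β` with respect to a nondegenerate form `B`, that is, the trace
of the endomorphism `B⁻¹ β`, as a linear function of `β`. It is the local counterpart of
`traceAt`. -/
def metricTrace (B : E →L[ℝ] E →L[ℝ] ℝ) : (E →L[ℝ] E →L[ℝ] ℝ) →ₗ[ℝ] ℝ :=
  LinearMap.trace ℝ E ∘ₗ ContinuousLinearMap.coeLM ℝ ∘ₗ
    (ContinuousLinearMap.compL ℝ E (E →L[ℝ] ℝ) E B.inverse).toLinearMap

theorem metricTrace_apply (B β : E →L[ℝ] E →L[ℝ] ℝ) :
    metricTrace B β = LinearMap.trace ℝ E (B.inverse.comp β : E →L[ℝ] E) := rfl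

theorem isInvertible_of_anisotropic [FiniteDimensional ℝ E] {B : E →L[ℝ] E →L[ℝ] ℝ}
    (hB : ∀ v, v ≠ 0 → B v v ≠ 0) : B.IsInvertible := by
  have hinj : Function.Injective B := (injective_iff_map_eq_zero B).2 fun v hv =>
    by_contra fun hv0 => hB v hv0 (by rw [hv, zero_apply])
  have hdim : Module.finrank ℝ E = Module.finrank ℝ (E →L[ℝ] ℝ) := by
    have e : (E →L[ℝ] ℝ) ≃ₗ[ℝ] Module.Dual ℝ E := LinearMap.toContinuousLinearMap.symm
    rw [e.finrank_eq, Subspace.dual_finrank_eq]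
  exact ⟨(LinearEquiv.ofInjectiveOfFinrankEq B.toLinearMap hinj hdim).toContinuousLinearEquiv, rfl⟩

end MetricTrace

section BlockForm

variable {E : Type*} [NormedAddCommGroup E] [NormedSpace ℝ E] {a b : ℝ}
  {β γ : E →L[ℝ] E →L[ℝ] ℝ}

/-- The bilinear form `a dt² ⊕ β` on `ℝ × E`. -/
def blockForm (a : ℝ) (β : E →L[ℝ] E →L[ℝ] ℝ) : (ℝ × E) →L[ℝ] (ℝ × E) →L[ℝ] ℝ :=
  a • pullback (ContinuousLinearMap.mul ℝ ℝ) (ContinuousLinearMap.fst ℝ ℝ E)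
    + pullback β (ContinuousLinearMap.snd ℝ ℝ E)

theorem blockForm_apply (u v : ℝ × E) :
    blockForm a β u v = a * (u.1 * v.1) + β u.2 v.2 := rfl

theorem blockForm_apply_prodMk (hb : b ≠ 0) (hγ : γ.IsInvertible) (u : ℝ × E) :
    blockForm b γ (b⁻¹ * (a * u.1), γ.inverse (β u.2)) = blockForm a β u := by
  apply ContinuousLinearMap.ext
  intro v
  rw [blockForm_apply, blockForm_apply, hγ.self_apply_inverse]
  field_simp

theorem isInvertible_blockForm (hb : b ≠ 0) (hγ : γ.IsInvertible) :
    (blockForm b γ).IsInvertible := by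
  let inv : ((ℝ × E) →L[ℝ] ℝ) →L[ℝ] ℝ × E :=
    (b⁻¹ • ContinuousLinearMap.apply ℝ ℝ ((1, 0) : ℝ × E)).prod
      (γ.inverse ∘L ContinuousLinearMap.precomp ℝ (ContinuousLinearMap.inr ℝ ℝ E))
  have hleft : blockForm b γ ∘L inv = .id ℝ _ := by
    ext L v
    · simp [inv, blockForm_apply, hb]
    · simp [inv, blockForm_apply, hγ.self_apply_inverse]
  have hspace (u : ℝ × E) : blockForm b γ u ∘L ContinuousLinearMap.inr ℝ ℝ E = γ u.2 := by
    ext v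
    simp [blockForm_apply]
  have hright : inv ∘L blockForm b γ = .id ℝ _ := by
    refine ContinuousLinearMap.ext fun u => Prod.ext ?_ ?_
    · simp [inv, blockForm_apply, hb]
    · simp [inv, hspace, hγ.inverse_apply_self]
  exact .of_inverse hleft hright

theorem inverse_blockForm_apply (hb : b ≠ 0) (hγ : γ.IsInvertible) (u : ℝ × E) :
    (blockForm b γ).inverse (blockForm a β u) = (b⁻¹ * (a * u.1), γ.inverse (β u.2)) := by
  rw [(isInvertible_blockForm hb hγ).inverse_apply_eq, blockForm_apply_prodMk hb hγ]

theorem metricTrace_blockForm [FiniteDimensional ℝ E] (hb : b ≠ 0) (hγ : γ.IsInvertible) :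
    metricTrace (blockForm b γ) (blockForm a β) = a / b + metricTrace γ β := by
  have hspace : LinearMap.snd ℝ ℝ E ∘ₗ ((blockForm b γ).inverse.comp (blockForm a β) :
      (ℝ × E) →L[ℝ] (ℝ × E)).toLinearMap ∘ₗ LinearMap.inr ℝ ℝ E
      = (γ.inverse.comp β : E →L[ℝ] E).toLinearMap := by
    ext u
    exact congr_arg Prod.snd (inverse_blockForm_apply hb hγ (0, u))
  rw [metricTrace_apply, metricTrace_apply, trace_ring_prod, hspace, ContinuousLinearMap.coe_coe,
    ContinuousLinearMap.comp_apply, inverse_blockForm_apply hb hγ]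
  simp only [mul_one]
  rw [inv_mul_eq_div]

end BlockForm

section Calculus

variable {𝕜 V X Y Z : Type*} [NontriviallyNormedField 𝕜] [NormedAddCommGroup V]
  [NormedSpace 𝕜 V] [NormedAddCommGroup X] [NormedSpace 𝕜 X] [NormedAddCommGroup Y]
  [NormedSpace 𝕜 Y] [NormedAddCommGroup Z] [NormedSpace 𝕜 Z]

theorem fderiv_clm_apply_const {A : V → X →L[𝕜] Z} {x : V} (hA : DifferentiableAt 𝕜 A x)
    (u : V) (v : X) : fderiv 𝕜 A x u v = fderiv 𝕜 (fun y => A y v) x u := by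
  simp [fderiv_clm_apply hA (differentiableAt_const v)]

theorem fderiv_clm_apply_const₂ {A : V → X →L[𝕜] Y →L[𝕜] Z} {x : V}
    (hA : DifferentiableAt 𝕜 A x) (u : V) (v : X) (w : Y) :
    fderiv 𝕜 A x u v w = fderiv 𝕜 (fun y => A y v w) x u := by
  rw [fderiv_clm_apply_const hA,
    fderiv_clm_apply_const (hA.clm_apply (differentiableAt_const v))]

theorem fderiv_comp_snd {h : X → Z} {z : Y × X} (hh : DifferentiableAt 𝕜 h z.2) (u : Y × X) :
    fderiv 𝕜 (fun z : Y × X => h z.2) z u = fderiv 𝕜 h z.2 u.2 := by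
  rw [fderiv_fun_comp (f := Prod.snd) z hh differentiableAt_snd, fderiv_snd]
  rfl

end Calculus

section BlockFormCalculus

variable {E V : Type*} [NormedAddCommGroup E] [NormedSpace ℝ E] [NormedAddCommGroup V]
  [NormedSpace ℝ V] {a : V → ℝ} {β : V → E →L[ℝ] E →L[ℝ] ℝ} {x : V}

theorem contDiffAt_blockForm {n : ℕ∞ω} (ha : ContDiffAt ℝ n a x) (hβ : ContDiffAt ℝ n β x) :
    ContDiffAt ℝ n (fun y => blockForm (a y) (β y)) x :=
  (ha.smul contDiffAt_const).add (contDiffAt_const.clm_comp (hβ.clm_comp contDiffAt_const))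

theorem fderiv_blockForm (ha : DifferentiableAt ℝ a x) (hβ : DifferentiableAt ℝ β x) (u : V) :
    fderiv ℝ (fun y => blockForm (a y) (β y)) x u
      = blockForm (fderiv ℝ a x u) (fderiv ℝ β x u) := by
  have hd : DifferentiableAt ℝ (fun y => blockForm (a y) (β y)) x :=
    (ha.smul_const _).add ((differentiableAt_const _).clm_comp
      (hβ.clm_comp (differentiableAt_const _)))
  refine ContinuousLinearMap.ext fun v => ContinuousLinearMap.ext fun w => ?_
  have hβvw : DifferentiableAt ℝ (fun y => β y v.2 w.2) x :=
    (hβ.clm_apply (differentiableAt_const _)).clm_apply (differentiableAt_const _)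
  rw [fderiv_clm_apply_const₂ hd, blockForm_apply, fderiv_clm_apply_const₂ hβ]
  simp only [blockForm_apply]
  rw [fderiv_fun_add (ha.mul_const _) hβvw, fderiv_mul_const ha]
  simp [mul_comm]

end BlockFormCalculus

section LeviCivita

variable {E : Type*} [NormedAddCommGroup E] [NormedSpace ℝ E]
  {G G' : E → E →L[ℝ] E →L[ℝ] ℝ} {h : E → ℝ} {x : E}

theorem christoffel_congr (hGG' : G =ᶠ[nhds x] G') : christoffel G =ᶠ[nhds x] christoffel G' := by
  filter_upwards [hGG', hGG'.fderiv (𝕜 := ℝ)] with y h₀ h₁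
  ext u v
  rw [christoffel_apply, christoffel_apply, koszul, koszul, h₀, h₁]

theorem localRicci_congr [FiniteDimensional ℝ E] (hGG' : G =ᶠ[nhds x] G') :
    localRicci G x = localRicci G' x := by
  have hΓ := christoffel_congr hGG'
  ext v w
  rw [localRicci_apply, localRicci_apply, curvatureEndo, curvatureEndo, hΓ.fderiv_eq,
    hΓ.eq_of_nhds]

theorem two_mul_apply_christoffel (hG : (G x).IsInvertible) (u v w : E) :
    2 * G x (christoffel G x u v) w = koszul G x u v w := by
  rw [christoffel_apply, map_smul, hG.self_apply_inverse, smul_apply, smul_eq_mul]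
  ring

theorem christoffel_eq_of_koszul (hG : (G x).IsInvertible) {u v X : E}
    (hX : ∀ w, 2 * G x X w = koszul G x u v w) : christoffel G x u v = X := by
  apply hG.injective
  ext w
  linarith [hX w, two_mul_apply_christoffel hG u v w]

/-- The gradient of `h` with respect to `G`. -/
def localGrad (G : E → E →L[ℝ] E →L[ℝ] ℝ) (h : E → ℝ) (x : E) : E :=
  (G x).inverse (fderiv ℝ h x)

theorem apply_localGrad (hG : (G x).IsInvertible) (h : E → ℝ) (w : E) :
    G x (localGrad G h x) w = fderiv ℝ h x w := by
  rw [localGrad, hG.self_apply_inverse]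

/-- Near `x`, the field `G` of bilinear forms is a pseudo-Riemannian metric that is regular enough
to have a curvature tensor: it is twice continuously differentiable, symmetric and nondegenerate.
Nondegeneracy is only required at `x`, being an open condition. -/
structure IsLocalMetric (G : E → E →L[ℝ] E →L[ℝ] ℝ) (x : E) : Prop where
  contDiffAt : ContDiffAt ℝ 2 G x
  isInvertible : (G x).IsInvertible
  symm : ∀ᶠ y in nhds x, ∀ u v, G y u v = G y v u

namespace IsLocalMetric

theorem differentiableAt (hG : IsLocalMetric G x) : DifferentiableAt ℝ G x :=
  hG.contDiffAt.differentiableAt two_ne_zero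

theorem differentiableAt_koszul (hG : IsLocalMetric G x) : DifferentiableAt ℝ (koszul G) x := by
  have hDG : DifferentiableAt ℝ (fderiv ℝ G) x :=
    (hG.contDiffAt.fderiv_right (m := 1) (by norm_num)).differentiableAt one_ne_zero
  have hflip : DifferentiableAt ℝ (fun y => (fderiv ℝ G y).flip) x :=
    (ContinuousLinearMap.flipₗᵢ ℝ E E (E →L[ℝ] ℝ)).toContinuousLinearEquiv.differentiableAt.comp
      x hDG
  exact (hDG.add hflip).sub ((differentiableAt_const _).clm_comp hflip)

theorem fderiv_symm (hG : IsLocalMetric G x) (w u v : E) :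
    fderiv ℝ G x w u v = fderiv ℝ G x w v u := by
  rw [fderiv_clm_apply_const₂ hG.differentiableAt, fderiv_clm_apply_const₂ hG.differentiableAt]
  have hsymm : (fun y => G y u v) =ᶠ[nhds x] fun y => G y v u := hG.symm.mono fun y hy => hy u v
  rw [hsymm.fderiv_eq]

theorem fderiv_eq_christoffel (hG : IsLocalMetric G x) (u v w : E) :
    fderiv ℝ G x u v w = G x (christoffel G x u v) w + G x (christoffel G x u w) v := by
  have hvw := two_mul_apply_christoffel hG.isInvertible u v w
  have hwv := two_mul_apply_christoffel hG.isInvertible u w v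
  rw [koszul_apply] at hvw hwv
  linarith [hG.fderiv_symm u v w, hG.fderiv_symm v u w, hG.fderiv_symm w u v]

variable [CompleteSpace E]

theorem eventually_isInvertible (hG : IsLocalMetric G x) :
    ∀ᶠ y in nhds x, (G y).IsInvertible :=
  hG.contDiffAt.continuousAt.eventually_mem
    (ContinuousLinearEquiv.isOpen.mem_nhds hG.isInvertible)

protected theorem eventually (hG : IsLocalMetric G x) : ∀ᶠ y in nhds x, IsLocalMetric G y := by
  filter_upwards [hG.contDiffAt.eventually (by simp), hG.eventually_isInvertible,
    hG.symm.eventually_nhds] with y hc hi hs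
  exact ⟨hc, hi, hs⟩

theorem differentiableAt_inverse (hG : IsLocalMetric G x) :
    DifferentiableAt ℝ (fun y => (G y).inverse) x :=
  (hG.isInvertible.contDiffAt_map_inverse.comp x hG.contDiffAt).differentiableAt two_ne_zero

theorem differentiableAt_christoffel (hG : IsLocalMetric G x) :
    DifferentiableAt ℝ (christoffel G) x :=
  (((ContinuousLinearMap.compL ℝ E (E →L[ℝ] ℝ) E).differentiableAt.comp x
    hG.differentiableAt_inverse).clm_comp hG.differentiableAt_koszul).const_smul (1 / 2 : ℝ)

theorem differentiableAt_localGrad (hG : IsLocalMetric G x)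
    (hh : DifferentiableAt ℝ (fderiv ℝ h) x) : DifferentiableAt ℝ (localGrad G h) x :=
  hG.differentiableAt_inverse.clm_apply hh

/-- Differentiate `G (grad h) w = dh w` along `u`. -/
theorem fderiv_localGrad_add_christoffel (hG : IsLocalMetric G x)
    (hh : DifferentiableAt ℝ (fderiv ℝ h) x) (u : E) :
    fderiv ℝ (localGrad G h) x u + christoffel G x u (localGrad G h x)
      = (G x).inverse (localHessian G h x u) := by
  rw [eq_comm, hG.isInvertible.inverse_apply_eq]
  ext w
  have hgrad := hG.differentiableAt_localGrad hh
  have hdual : (fun y => G y (localGrad G h y) w) =ᶠ[nhds x] fun y => fderiv ℝ h y w :=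
    hG.eventually_isInvertible.mono fun y hy => apply_localGrad hy h w
  have hleft : fderiv ℝ (fun y => G y (localGrad G h y) w) x u
      = fderiv ℝ G x u (localGrad G h x) w + G x (fderiv ℝ (localGrad G h) x u) w := by
    rw [← fderiv_clm_apply_const (hG.differentiableAt.clm_apply hgrad),
      fderiv_clm_apply hG.differentiableAt hgrad]
    simp [add_comm]
  have hright : fderiv ℝ (fun y => fderiv ℝ h y w) x u = fderiv ℝ (fderiv ℝ h) x u w :=
    (fderiv_clm_apply_const hh u w).symm
  have hskew := hG.fderiv_eq_christoffel u (localGrad G h x) w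
  rw [hG.symm.self_of_nhds _ (localGrad G h x), apply_localGrad hG.isInvertible] at hskew
  rw [hdual.fderiv_eq, hright, hskew] at hleft
  rw [localHessian_apply, hleft, map_add, add_apply]
  ring

end IsLocalMetric

end LeviCivita

section LocalTensors

variable {E : Type*} [NormedAddCommGroup E] [NormedSpace ℝ E]

/-- The Laplace-Beltrami operator in coordinates, the local counterpart of `laplacian`. -/
def localLaplacian (G : E → E →L[ℝ] E →L[ℝ] ℝ) (h : E → ℝ) (x : E) : ℝ :=
  metricTrace (G x) (localHessian G h x)

variable [FiniteDimensional ℝ E]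

/-- The scalar curvature in coordinates, the local counterpart of `scalarCurvature`. -/
def localScalarCurvature (G : E → E →L[ℝ] E →L[ℝ] ℝ) (x : E) : ℝ :=
  metricTrace (G x) (localRicci G x)

/-- The tensor `ℒ*_G h` in coordinates, the local counterpart of `adjointScalar`. -/
def localAdjointScalar (G : E → E →L[ℝ] E →L[ℝ] ℝ) (h : E → ℝ) (x : E) : E →L[ℝ] E →L[ℝ] ℝ :=
  -(h x • localRicci G x) - localLaplacian G h x • G x + localHessian G h x

/-- The Einstein tensor `Ric - (1/2) τ G` in coordinates; `energyMomentum` is its global counterpart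
up to the factor `8 π`. -/
def localEinstein (G : E → E →L[ℝ] E →L[ℝ] ℝ) (x : E) : E →L[ℝ] E →L[ℝ] ℝ :=
  localRicci G x - (1 / 2 * localScalarCurvature G x) • G x

theorem localEinstein_congr {G G' : E → E →L[ℝ] E →L[ℝ] ℝ} {x : E} (h : G =ᶠ[nhds x] G') :
    localEinstein G x = localEinstein G' x := by
  rw [localEinstein, localEinstein, localScalarCurvature, localScalarCurvature,
    localRicci_congr h, h.eq_of_nhds]

end LocalTensors

section LocalStatic

variable {E : Type*} [NormedAddCommGroup E] [NormedSpace ℝ E]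
  {φ : E → ℝ} {γ : E → E →L[ℝ] E →L[ℝ] ℝ} {y : E} {z : ℝ × E}

/-- The coordinate expression `-φ² dt² ⊕ γ` of a static metric. -/
def localStatic (φ : E → ℝ) (γ : E → E →L[ℝ] E →L[ℝ] ℝ) (z : ℝ × E) :
    (ℝ × E) →L[ℝ] (ℝ × E) →L[ℝ] ℝ :=
  blockForm (-φ z.2 ^ 2) (γ z.2)

/-- The one-form `d log φ`, written so that it makes sense for `φ` of any sign. -/
def logDifferential (φ : E → ℝ) (y : E) : E →L[ℝ] ℝ :=
  (φ y)⁻¹ • fderiv ℝ φ y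

/-- The covariant derivative `∇_∂t ∂t = φ grad φ` of the static metric `-φ² dt² ⊕ γ`. -/
def staticAcceleration (φ : E → ℝ) (γ : E → E →L[ℝ] E →L[ℝ] ℝ) (y : E) : E :=
  φ y • localGrad γ φ y

theorem isInvertible_localStatic (h₀ : φ z.2 ≠ 0) (hγ : (γ z.2).IsInvertible) :
    (localStatic φ γ z).IsInvertible :=
  isInvertible_blockForm (neg_ne_zero.2 (pow_ne_zero 2 h₀)) hγ

theorem contDiffAt_localStatic {n : ℕ∞ω} (hφ : ContDiffAt ℝ n φ z.2)
    (hγ : ContDiffAt ℝ n γ z.2) : ContDiffAt ℝ n (localStatic φ γ) z :=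
  contDiffAt_blockForm ((hφ.comp z contDiffAt_snd).pow 2).neg (hγ.comp z contDiffAt_snd)

theorem fderiv_localStatic (hφ : DifferentiableAt ℝ φ z.2) (hγ : DifferentiableAt ℝ γ z.2)
    (u : ℝ × E) :
    fderiv ℝ (localStatic φ γ) z u
      = blockForm (-(2 * φ z.2 * fderiv ℝ φ z.2 u.2)) (fderiv ℝ γ z.2 u.2) := by
  have hlapse : HasFDerivAt (fun y => -φ y ^ 2) _ z.2 := (hφ.hasFDerivAt.pow 2).neg
  have hφz : DifferentiableAt ℝ (fun z : ℝ × E => -φ z.2 ^ 2) z :=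
    hlapse.differentiableAt.comp z differentiableAt_snd
  have hγz : DifferentiableAt ℝ (fun z : ℝ × E => γ z.2) z := hγ.comp z differentiableAt_snd
  unfold localStatic
  rw [fderiv_blockForm hφz hγz, fderiv_comp_snd hγ,
    fderiv_comp_snd (h := fun y => -φ y ^ 2) hlapse.differentiableAt, hlapse.fderiv]
  simp

theorem isLocalMetric_localStatic (h₀ : φ z.2 ≠ 0) (hφ : ContDiffAt ℝ 2 φ z.2)
    (hγ : IsLocalMetric γ z.2) : IsLocalMetric (localStatic φ γ) z where
  contDiffAt := contDiffAt_localStatic hφ hγ.contDiffAt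
  isInvertible := isInvertible_localStatic h₀ hγ.isInvertible
  symm := by
    filter_upwards [continuous_snd.continuousAt.eventually hγ.symm] with z hsymm u v
    rw [localStatic, blockForm_apply, blockForm_apply, mul_comm u.1, hsymm]

theorem christoffel_localStatic (h₀ : φ z.2 ≠ 0) (hφ : DifferentiableAt ℝ φ z.2)
    (hi : (γ z.2).IsInvertible) (hγ : DifferentiableAt ℝ γ z.2) (u v : ℝ × E) :
    christoffel (localStatic φ γ) z u v
      = (logDifferential φ z.2 u.2 * v.1 + logDifferential φ z.2 v.2 * u.1,
        christoffel γ z.2 u.2 v.2 + (u.1 * v.1) • staticAcceleration φ γ z.2) := by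
  refine christoffel_eq_of_koszul (isInvertible_localStatic h₀ hi) fun w => ?_
  have hΓ := two_mul_apply_christoffel hi u.2 v.2 w.2
  have hgrad := apply_localGrad hi φ w.2
  rw [koszul_apply] at hΓ ⊢
  simp only [fderiv_localStatic hφ hγ, localStatic, blockForm_apply, logDifferential,
    staticAcceleration, map_add, map_smul, add_apply, smul_apply, smul_eq_mul, hgrad]
  field_simp
  linear_combination hΓ

theorem differentiableAt_logDifferential (h₀ : φ y ≠ 0) (hφ : ContDiffAt ℝ 2 φ y) :
    DifferentiableAt ℝ (logDifferential φ) y :=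
  ((hφ.differentiableAt two_ne_zero).inv h₀).smul
    ((hφ.fderiv_right (m := 1) (by norm_num)).differentiableAt one_ne_zero)

theorem fderiv_logDifferential_apply (h₀ : φ y ≠ 0) (hφ : ContDiffAt ℝ 2 φ y) (u v : E) :
    fderiv ℝ (logDifferential φ) y u v
      = fderiv ℝ (fderiv ℝ φ) y u v / φ y - logDifferential φ y u * logDifferential φ y v := by
  have hd := hφ.differentiableAt two_ne_zero
  have hdd : DifferentiableAt ℝ (fderiv ℝ φ) y :=
    (hφ.fderiv_right (m := 1) (by norm_num)).differentiableAt one_ne_zero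
  have hinv : HasFDerivAt (fun y => (φ y)⁻¹) _ y :=
    (hasDerivAt_inv h₀).comp_hasFDerivAt y hd.hasFDerivAt
  have hlog : HasFDerivAt (logDifferential φ) _ y := hinv.smul hdd.hasFDerivAt
  rw [hlog.fderiv]
  simp only [neg_smul, add_apply, smul_apply, ContinuousLinearMap.smulRight_apply, neg_apply,
    smul_eq_mul, logDifferential]
  field_simp
  ring

variable [CompleteSpace E]

theorem differentiableAt_staticAcceleration (hφ : ContDiffAt ℝ 2 φ y) (hγ : IsLocalMetric γ y) :
    DifferentiableAt ℝ (staticAcceleration φ γ) y :=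
  (hφ.differentiableAt two_ne_zero).smul <| hγ.differentiableAt_localGrad <|
    (hφ.fderiv_right (m := 1) (by norm_num)).differentiableAt one_ne_zero

theorem fderiv_staticAcceleration_add_christoffel (h₀ : φ y ≠ 0) (hφ : ContDiffAt ℝ 2 φ y)
    (hγ : IsLocalMetric γ y) (u : E) :
    fderiv ℝ (staticAcceleration φ γ) y u + christoffel γ y u (staticAcceleration φ γ y)
      = logDifferential φ y u • staticAcceleration φ γ y
        + φ y • (γ y).inverse (localHessian γ φ y u) := by
  have hd := hφ.differentiableAt two_ne_zero
  have hdd : DifferentiableAt ℝ (fderiv ℝ φ) y :=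
    (hφ.fderiv_right (m := 1) (by norm_num)).differentiableAt one_ne_zero
  have hacc : HasFDerivAt (staticAcceleration φ γ) _ y :=
    hd.hasFDerivAt.smul (hγ.differentiableAt_localGrad hdd).hasFDerivAt
  have hcancel : logDifferential φ y u • staticAcceleration φ γ y
      = fderiv ℝ φ y u • localGrad γ φ y := by
    rw [logDifferential, staticAcceleration, smul_apply, smul_smul, smul_eq_mul]
    field_simp
  rw [hcancel, ← hγ.fderiv_localGrad_add_christoffel hdd, hacc.fderiv, staticAcceleration]
  simp only [map_smul, add_apply, smul_apply, ContinuousLinearMap.smulRight_apply]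
  module

theorem christoffel_localStatic_eventuallyEq (h₀ : φ z.2 ≠ 0) (hφ : ContDiffAt ℝ 2 φ z.2)
    (hγ : IsLocalMetric γ z.2) (u v : ℝ × E) :
    (fun z => christoffel (localStatic φ γ) z u v) =ᶠ[nhds z]
      fun z => (logDifferential φ z.2 u.2 * v.1 + logDifferential φ z.2 v.2 * u.1,
        christoffel γ z.2 u.2 v.2 + (u.1 * v.1) • staticAcceleration φ γ z.2) := by
  have hnear : ∀ᶠ y in nhds z.2, φ y ≠ 0 ∧ ContDiffAt ℝ 2 φ y ∧ IsLocalMetric γ y :=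
    (hφ.continuousAt.eventually_ne h₀).and ((hφ.eventually (by simp)).and hγ.eventually)
  filter_upwards [continuous_snd.continuousAt.eventually hnear] with z ⟨h₀, hφ, hγ⟩
  exact christoffel_localStatic h₀ (hφ.differentiableAt two_ne_zero) hγ.isInvertible
    hγ.differentiableAt u v

theorem fderiv_christoffel_localStatic (h₀ : φ z.2 ≠ 0) (hφ : ContDiffAt ℝ 2 φ z.2)
    (hγ : IsLocalMetric γ z.2) (u v w : ℝ × E) :
    fderiv ℝ (christoffel (localStatic φ γ)) z u v w
      = (fderiv ℝ (logDifferential φ) z.2 u.2 v.2 * w.1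
          + fderiv ℝ (logDifferential φ) z.2 u.2 w.2 * v.1,
        fderiv ℝ (christoffel γ) z.2 u.2 v.2 w.2
          + (v.1 * w.1) • fderiv ℝ (staticAcceleration φ γ) z.2 u.2) := by
  have hθ := differentiableAt_logDifferential h₀ hφ
  have hΓ := hγ.differentiableAt_christoffel
  have hX := differentiableAt_staticAcceleration hφ hγ
  have hθv (v : E) : DifferentiableAt ℝ (fun y => logDifferential φ y v) z.2 :=
    hθ.clm_apply (differentiableAt_const v)
  have hΓvw : DifferentiableAt ℝ (fun y => christoffel γ y v.2 w.2) z.2 :=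
    (hΓ.clm_apply (differentiableAt_const _)).clm_apply (differentiableAt_const _)
  have h : HasFDerivAt (fun y => (logDifferential φ y v.2 * w.1 + logDifferential φ y w.2 * v.1,
      christoffel γ y v.2 w.2 + (v.1 * w.1) • staticAcceleration φ γ y)) _ z.2 :=
    (((hθv v.2).hasFDerivAt.mul_const w.1).add ((hθv w.2).hasFDerivAt.mul_const v.1)).prodMk
      (hΓvw.hasFDerivAt.add (hX.hasFDerivAt.const_smul (v.1 * w.1)))
  rw [fderiv_clm_apply_const₂ (isLocalMetric_localStatic h₀ hφ hγ).differentiableAt_christoffel,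
    (christoffel_localStatic_eventuallyEq h₀ hφ hγ v w).fderiv_eq,
    fderiv_comp_snd (h := fun y => (logDifferential φ y v.2 * w.1 + logDifferential φ y w.2 * v.1,
      christoffel γ y v.2 w.2 + (v.1 * w.1) • staticAcceleration φ γ y)) h.differentiableAt,
    h.fderiv]
  simp [fderiv_clm_apply_const hθ, fderiv_clm_apply_const₂ hΓ, mul_comm]

theorem fst_curvatureEndo_localStatic (h₀ : φ z.2 ≠ 0) (hφ : ContDiffAt ℝ 2 φ z.2)
    (hγ : IsLocalMetric γ z.2) (v w : ℝ × E) :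
    (curvatureEndo (localStatic φ γ) z v w (1, 0)).1 = -(localHessian γ φ z.2 v.2 w.2 / φ z.2) := by
  have hΓ (u v : ℝ × E) := (christoffel_localStatic_eventuallyEq h₀ hφ hγ u v).self_of_nhds
  have hDΓ := fderiv_christoffel_localStatic h₀ hφ hγ
  have hHess : logDifferential φ z.2 (christoffel γ z.2 v.2 w.2)
      - fderiv ℝ (logDifferential φ) z.2 v.2 w.2
      - logDifferential φ z.2 v.2 * logDifferential φ z.2 w.2
      = -(localHessian γ φ z.2 v.2 w.2 / φ z.2) := by
    rw [fderiv_logDifferential_apply h₀ hφ, localHessian_apply, logDifferential]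
    simp only [smul_apply, smul_eq_mul]
    ring
  rw [curvatureEndo_apply, ← hHess]
  simp only [hΓ, hDΓ, map_zero, map_add, map_smul, zero_apply, smul_eq_mul,
    Prod.fst_add, Prod.fst_sub]
  ring

theorem snd_curvatureEndo_localStatic (h₀ : φ z.2 ≠ 0) (hφ : ContDiffAt ℝ 2 φ z.2)
    (hγ : IsLocalMetric γ z.2) (v w : ℝ × E) (u : E) :
    (curvatureEndo (localStatic φ γ) z v w (0, u)).2
      = curvatureEndo γ z.2 v.2 w.2 u
        + (φ z.2 * (v.1 * w.1)) • (γ z.2).inverse (localHessian γ φ z.2 u) := by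
  have hΓ (u v : ℝ × E) := (christoffel_localStatic_eventuallyEq h₀ hφ hγ u v).self_of_nhds
  have hDΓ := fderiv_christoffel_localStatic h₀ hφ hγ
  have hacc : (φ z.2 * (v.1 * w.1)) • (γ z.2).inverse (localHessian γ φ z.2 u)
      = (v.1 * w.1) • (fderiv ℝ (staticAcceleration φ γ) z.2 u
        + christoffel γ z.2 u (staticAcceleration φ γ z.2)
        - logDifferential φ z.2 u • staticAcceleration φ γ z.2) := by
    rw [fderiv_staticAcceleration_add_christoffel h₀ hφ hγ]
    module
  rw [curvatureEndo_apply, curvatureEndo_apply, hacc]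
  simp only [hΓ, hDΓ, map_add, map_smul, Prod.snd_add, Prod.snd_sub]
  module

end LocalStatic

section LocalStaticRicci

variable {E : Type*} [NormedAddCommGroup E] [NormedSpace ℝ E] [FiniteDimensional ℝ E]
  {φ : E → ℝ} {γ : E → E →L[ℝ] E →L[ℝ] ℝ} {z : ℝ × E}

theorem localRicci_localStatic (h₀ : φ z.2 ≠ 0) (hφ : ContDiffAt ℝ 2 φ z.2)
    (hγ : IsLocalMetric γ z.2) :
    localRicci (localStatic φ γ) z
      = blockForm (φ z.2 * localLaplacian γ φ z.2)
        (localRicci γ z.2 - (φ z.2)⁻¹ • localHessian γ φ z.2) := by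
  have := FiniteDimensional.complete ℝ E
  refine ContinuousLinearMap.ext fun v => ContinuousLinearMap.ext fun w => ?_
  have hspace : LinearMap.snd ℝ ℝ E ∘ₗ
      (curvatureEndo (localStatic φ γ) z v w : (ℝ × E) →ₗ[ℝ] ℝ × E) ∘ₗ LinearMap.inr ℝ ℝ E
      = (curvatureEndo γ z.2 v.2 w.2 : E →ₗ[ℝ] E) + (φ z.2 * (v.1 * w.1)) •
        ((γ z.2).inverse.comp (localHessian γ φ z.2) : E →L[ℝ] E).toLinearMap :=
    LinearMap.ext fun u => snd_curvatureEndo_localStatic h₀ hφ hγ v w u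
  rw [localRicci_apply, trace_ring_prod, hspace, ContinuousLinearMap.coe_coe,
    fst_curvatureEndo_localStatic h₀ hφ hγ, map_add, map_smul, ← metricTrace_apply,
    ← localRicci_apply, ← localLaplacian, blockForm_apply]
  simp only [sub_apply, smul_apply, smul_eq_mul]
  ring

theorem localScalarCurvature_localStatic (h₀ : φ z.2 ≠ 0) (hφ : ContDiffAt ℝ 2 φ z.2)
    (hγ : IsLocalMetric γ z.2) :
    localScalarCurvature (localStatic φ γ) z
      = localScalarCurvature γ z.2 - 2 * localLaplacian γ φ z.2 / φ z.2 := by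
  rw [localScalarCurvature, localRicci_localStatic h₀ hφ hγ, localStatic,
    metricTrace_blockForm (neg_ne_zero.2 (pow_ne_zero 2 h₀)) hγ.isInvertible, map_sub, map_smul,
    ← localScalarCurvature, ← localLaplacian, smul_eq_mul]
  field_simp
  ring

theorem localEinstein_localStatic (h₀ : φ z.2 ≠ 0) (hφ : ContDiffAt ℝ 2 φ z.2)
    (hγ : IsLocalMetric γ z.2) :
    localEinstein (localStatic φ γ) z
      = -((φ z.2)⁻¹ • pullback (localAdjointScalar γ φ z.2) (ContinuousLinearMap.snd ℝ ℝ E))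
        - (1 / 2 * localScalarCurvature γ z.2) • localStatic φ γ z := by
  refine ContinuousLinearMap.ext fun v => ContinuousLinearMap.ext fun w => ?_
  rw [localEinstein, localRicci_localStatic h₀ hφ hγ, localScalarCurvature_localStatic h₀ hφ hγ,
    localStatic, localAdjointScalar]
  simp only [add_apply, sub_apply, smul_apply, neg_apply, blockForm_apply, pullback_apply,
    ContinuousLinearMap.coe_snd', smul_eq_mul]
  field_simp
  ring

end LocalStaticRicci

section Chart

variable {E : Type*} [NormedAddCommGroup E] [NormedSpace ℝ E]
  {H : Type*} [TopologicalSpace H] {I : ModelWithCorners ℝ E H}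
  {M : Type*} [TopologicalSpace M] [ChartedSpace H M] [IsManifold I 1 M]
  {g : ∀ p : M, TangentSpace I p →L[ℝ] TangentSpace I p →L[ℝ] ℝ} {p : M}

theorem inChart_self : inChart I g p (extChartAt I p p) = g p := by
  rw [inChart, mfderivWithin_range_extChartAt_symm]
  have hbase := congr_arg (fun q => show E →L[ℝ] E →L[ℝ] ℝ from g q)
    (extChartAt_to_inv (I := I) p)
  exact hbase

theorem hessian_eq_localHessian (f : M → ℝ) :
    hessian I g f p
      = localHessian (inChart I g p) (f ∘ (extChartAt I p).symm) (extChartAt I p p) := by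
  rw [hessian, mfderiv_extChartAt_self]
  rfl

theorem laplacian_eq_localLaplacian (f : M → ℝ) :
    laplacian I g f p
      = localLaplacian (inChart I g p) (f ∘ (extChartAt I p).symm) (extChartAt I p p) := by
  rw [laplacian, hessian_eq_localHessian, localLaplacian, inChart_self]
  rfl

variable [FiniteDimensional ℝ E]

theorem ricci_eq_localRicci :
    ricci I g p = localRicci (inChart I g p) (extChartAt I p p) := by
  rw [ricci, mfderiv_extChartAt_self]
  rfl

theorem scalarCurvature_eq_localScalarCurvature :
    scalarCurvature I g p = localScalarCurvature (inChart I g p) (extChartAt I p p) := by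
  rw [scalarCurvature, ricci_eq_localRicci, localScalarCurvature, inChart_self]
  rfl

theorem adjointScalar_eq_localAdjointScalar (f : M → ℝ) :
    adjointScalar I g f p
      = localAdjointScalar (inChart I g p) (f ∘ (extChartAt I p).symm) (extChartAt I p p) := by
  rw [adjointScalar, ricci_eq_localRicci, laplacian_eq_localLaplacian, hessian_eq_localHessian,
    localAdjointScalar, inChart_self, Function.comp_apply, extChartAt_to_inv]
  rfl

theorem smul_energyMomentum_eq_localEinstein :
    (8 * Real.pi) • energyMomentum I g p
      = localEinstein (inChart I g p) (extChartAt I p p) := by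
  rw [energyMomentum, smul_smul, mul_one_div_cancel (by positivity), one_smul, ricci_eq_localRicci,
    scalarCurvature_eq_localScalarCurvature, localEinstein, inChart_self]
  rfl

end Chart

section PseudoRiemannianMetric

variable {E : Type*} [NormedAddCommGroup E] [NormedSpace ℝ E]
  {H : Type*} [TopologicalSpace H] {I : ModelWithCorners ℝ E H}
  {M : Type*} [TopologicalSpace M] [ChartedSpace H M] {n : ℕ∞ω}

/-- The field `g` of bilinear forms is a pseudo-Riemannian metric of class `C^n`: a `C^n` section
of the bundle of bilinear forms on the tangent spaces whose values are symmetric and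
nondegenerate. -/
structure IsPseudoRiemannianMetric (I : ModelWithCorners ℝ E H) [IsManifold I 1 M] (n : ℕ∞ω)
    (g : ∀ p : M, TangentSpace I p →L[ℝ] TangentSpace I p →L[ℝ] ℝ) : Prop where
  contMDiff : ContMDiff I (I.prod 𝓘(ℝ, E →L[ℝ] E →L[ℝ] ℝ)) n
    (fun p => Bundle.TotalSpace.mk' (E →L[ℝ] E →L[ℝ] ℝ) p (g p))
  symm : ∀ p u v, g p u v = g p v u
  isInvertible : ∀ p, (g p).IsInvertible

theorem isPseudoRiemannianMetric_inner [FiniteDimensional ℝ E] [IsManifold I 1 M]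
    (g : Bundle.ContMDiffRiemannianMetric I n E (fun p : M => TangentSpace I p)) :
    IsPseudoRiemannianMetric I n g.inner where
  contMDiff := g.contMDiff
  symm := g.symm
  isInvertible p := isInvertible_of_anisotropic (E := E) fun v hv => (g.pos p v hv).ne'

theorem IsPseudoRiemannianMetric.of_le {m : ℕ∞ω} [IsManifold I 1 M]
    {g : ∀ p : M, TangentSpace I p →L[ℝ] TangentSpace I p →L[ℝ] ℝ}
    (hg : IsPseudoRiemannianMetric I n g) (hmn : m ≤ n) : IsPseudoRiemannianMetric I m g :=
  ⟨hg.contMDiff.of_le hmn, hg.symm, hg.isInvertible⟩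

variable [IsManifold I 1 M] [IsManifold I (n + 1) M]
  {g : ∀ p : M, TangentSpace I p →L[ℝ] TangentSpace I p →L[ℝ] ℝ} {p : M}

theorem contMDiffOn_mfderivWithin_extChartAt_symm (v : E) :
    ContMDiffOn 𝓘(ℝ, E) (I.prod 𝓘(ℝ, E)) n
      (fun y => Bundle.TotalSpace.mk' E (E := fun p : M => TangentSpace I p)
        ((extChartAt I p).symm y)
        (mfderivWithin 𝓘(ℝ, E) I (extChartAt I p).symm (Set.range I) y v))
      (extChartAt I p).target := by
  have htangent :=
    (contMDiffOn_extChartAt_symm (I := I) (n := n + 1) p).contMDiffOn_tangentMapWithin le_rfl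
      (uniqueDiffOn_extChartAt_target p).uniqueMDiffOn
  have hconst : ContMDiff 𝓘(ℝ, E) 𝓘(ℝ, E).tangent n
      (fun y : E => (⟨y, v⟩ : TangentBundle 𝓘(ℝ, E) E)) :=
    (contMDiff_vectorSpace_iff_contDiff (V := fun _ => v)).2 contDiff_const
  refine (htangent.comp hconst.contMDiffOn fun y hy => hy).congr fun y hy => ?_
  rw [← mfderivWithin_congr_set (extChartAt_target_eventuallyEq_of_mem hy)]
  rfl

theorem IsPseudoRiemannianMetric.contDiffOn_inChart [FiniteDimensional ℝ E]
    (hg : IsPseudoRiemannianMetric I n g) :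
    ContDiffOn ℝ n (inChart I g p) (extChartAt I p).target := by
  refine contDiffOn_clm_apply.2 fun u => contDiffOn_clm_apply.2 fun v => ?_
  have hsymm : ContMDiffOn 𝓘(ℝ, E) I n (extChartAt I p).symm (extChartAt I p).target :=
    (contMDiffOn_extChartAt_symm (n := n + 1) p).of_le le_self_add
  have happly : ContMDiffOn 𝓘(ℝ, E) (I.prod 𝓘(ℝ, ℝ)) n
      (fun y => Bundle.TotalSpace.mk' ℝ (E := Bundle.Trivial M ℝ)
        ((extChartAt I p).symm y) (inChart I g p y u v)) (extChartAt I p).target :=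
    (hg.contMDiff.comp_contMDiffOn hsymm).clm_bundle_apply₂ (F₁ := E) (F₂ := E)
      (contMDiffOn_mfderivWithin_extChartAt_symm u) (contMDiffOn_mfderivWithin_extChartAt_symm v)
  rw [← contMDiffOn_iff_contDiffOn]
  exact fun y hy => (Bundle.contMDiffWithinAt_totalSpace.1 (happly y hy)).2

end PseudoRiemannianMetric

section Boundaryless

variable {E : Type*} [NormedAddCommGroup E] [NormedSpace ℝ E]
  {H : Type*} [TopologicalSpace H] {I : ModelWithCorners ℝ E H} [I.Boundaryless]
  {M : Type*} [TopologicalSpace M] [ChartedSpace H M] {p : M}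

theorem contDiffAt_comp_extChartAt_symm {n : ℕ∞ω} [IsManifold I n M] {f : M → ℝ}
    (hf : ContMDiff I 𝓘(ℝ, ℝ) n f) :
    ContDiffAt ℝ n (f ∘ (extChartAt I p).symm) (extChartAt I p p) :=
  (hf.comp_contMDiffOn (contMDiffOn_extChartAt_symm p)).contDiffOn.contDiffAt
    (extChartAt_target_mem_nhds p)

theorem IsPseudoRiemannianMetric.isLocalMetric_inChart [FiniteDimensional ℝ E]
    [IsManifold I 3 M] {g : ∀ p : M, TangentSpace I p →L[ℝ] TangentSpace I p →L[ℝ] ℝ}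
    (hg : IsPseudoRiemannianMetric I 2 g) : IsLocalMetric (inChart I g p) (extChartAt I p p) where
  contDiffAt :=
    have : IsManifold I (2 + 1) M := ‹IsManifold I 3 M›
    hg.contDiffOn_inChart.contDiffAt (extChartAt_target_mem_nhds p)
  isInvertible := by
    rw [inChart_self]
    exact hg.isInvertible p
  symm := .of_forall fun _ _ _ => hg.symm _ _ _

end Boundaryless

section ChartDerivative

variable {E E' : Type*} [NormedAddCommGroup E] [NormedSpace ℝ E] [NormedAddCommGroup E']
  [NormedSpace ℝ E'] {H H' : Type*} [TopologicalSpace H] [TopologicalSpace H']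
  {I : ModelWithCorners ℝ E H} {I' : ModelWithCorners ℝ E' H'}
  {M M' : Type*} [TopologicalSpace M] [ChartedSpace H M] [IsManifold I 1 M]
  [TopologicalSpace M'] [ChartedSpace H' M'] {p : M} {y : E}

theorem mfderiv_comp_mfderivWithin_extChartAt_symm {h : M → M'}
    (hy : y ∈ (extChartAt I p).target) (hh : MDifferentiableAt I I' h ((extChartAt I p).symm y)) :
    (mfderiv I I' h ((extChartAt I p).symm y)).comp
        (mfderivWithin 𝓘(ℝ, E) I (extChartAt I p).symm (Set.range I) y)
      = mfderivWithin 𝓘(ℝ, E) I' (h ∘ (extChartAt I p).symm) (Set.range I) y :=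
  (mfderiv_comp_mfderivWithin y hh (mdifferentiableWithinAt_extChartAt_symm hy)
    (I.uniqueMDiffOn _ (extChartAt_target_subset_range p hy))).symm

end ChartDerivative

section Causal

variable {E : Type*} [NormedAddCommGroup E] [NormedSpace ℝ E]
  {H : Type*} [TopologicalSpace H] {I : ModelWithCorners ℝ E H}
  {M : Type*} [TopologicalSpace M] [ChartedSpace H M]

theorem isCausal_of_apply_self_neg
    {g : ∀ p : M, TangentSpace I p →L[ℝ] TangentSpace I p →L[ℝ] ℝ} {p : M} {w : TangentSpace I p}
    (hw : g p w w < 0) : IsCausal I g p w :=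
  ⟨fun h => hw.ne (by rw [h, map_zero]), hw.le⟩

end Causal

section StaticMetric

variable {E : Type*} [NormedAddCommGroup E] [NormedSpace ℝ E]
  {F : Type*} [TopologicalSpace F] [ChartedSpace E F] [IsManifold 𝓘(ℝ, E) 1 F]
  {J : TopologicalSpace.Opens ℝ} {f : F → ℝ}
  {gF : ∀ p : F, TangentSpace 𝓘(ℝ, E) p →L[ℝ] TangentSpace 𝓘(ℝ, E) p →L[ℝ] ℝ} {x : J × F}

theorem dt_comp_mfderivWithin_extChartAt_symm {z : ℝ × E}
    (hz : z ∈ (extChartAt (𝓘(ℝ, ℝ).prod 𝓘(ℝ, E)) x).target) :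
    (dt J ((extChartAt (𝓘(ℝ, ℝ).prod 𝓘(ℝ, E)) x).symm z)).comp
      (mfderivWithin 𝓘(ℝ, ℝ × E) (𝓘(ℝ, ℝ).prod 𝓘(ℝ, E))
        (extChartAt (𝓘(ℝ, ℝ).prod 𝓘(ℝ, E)) x).symm
        (Set.range (𝓘(ℝ, ℝ).prod 𝓘(ℝ, E))) z) = ContinuousLinearMap.fst ℝ ℝ E := by
  have ht : MDifferentiableAt (𝓘(ℝ, ℝ).prod 𝓘(ℝ, E)) 𝓘(ℝ, ℝ) (fun y : J × F => (y.1 : ℝ))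
      ((extChartAt (𝓘(ℝ, ℝ).prod 𝓘(ℝ, E)) x).symm z) :=
    (contMDiff_subtype_val.comp contMDiff_fst).mdifferentiable one_ne_zero _
  have hfst : (fun y : J × F => (y.1 : ℝ)) ∘ (extChartAt (𝓘(ℝ, ℝ).prod 𝓘(ℝ, E)) x).symm
      =ᶠ[nhds z] Prod.fst := by
    filter_upwards [(isOpen_extChartAt_target x).mem_nhds hz] with y hy
    exact congr_arg Prod.fst ((extChartAt (𝓘(ℝ, ℝ).prod 𝓘(ℝ, E)) x).right_inv hy)
  refine (mfderiv_comp_mfderivWithin_extChartAt_symm hz ht).trans ?_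
  rw [ModelWithCorners.range_eq_univ, mfderivWithin_univ, hfst.mfderiv_eq, mfderiv_eq_fderiv,
    fderiv_fst]

theorem mfderiv_snd_comp_mfderivWithin_extChartAt_symm {z : ℝ × E}
    (hz : z ∈ (extChartAt (𝓘(ℝ, ℝ).prod 𝓘(ℝ, E)) x).target) :
    (mfderiv (𝓘(ℝ, ℝ).prod 𝓘(ℝ, E)) 𝓘(ℝ, E) (Prod.snd : J × F → F)
        ((extChartAt (𝓘(ℝ, ℝ).prod 𝓘(ℝ, E)) x).symm z)).comp
      (mfderivWithin 𝓘(ℝ, ℝ × E) (𝓘(ℝ, ℝ).prod 𝓘(ℝ, E))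
        (extChartAt (𝓘(ℝ, ℝ).prod 𝓘(ℝ, E)) x).symm
        (Set.range (𝓘(ℝ, ℝ).prod 𝓘(ℝ, E))) z)
      = (mfderivWithin 𝓘(ℝ, E) 𝓘(ℝ, E) (extChartAt 𝓘(ℝ, E) x.2).symm
          (Set.range 𝓘(ℝ, E)) z.2 : E →L[ℝ] E).comp (ContinuousLinearMap.snd ℝ ℝ E) := by
  have hz₂ : z.2 ∈ (extChartAt 𝓘(ℝ, E) x.2).target := by
    rw [extChartAt_prod, PartialEquiv.prod_target] at hz
    exact hz.2
  have hchart := mdifferentiableWithinAt_extChartAt_symm (I := 𝓘(ℝ, E)) hz₂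
  rw [ModelWithCorners.range_eq_univ, mdifferentiableWithinAt_univ] at hchart
  have hsnd : (Prod.snd : J × F → F) ∘ (extChartAt (𝓘(ℝ, ℝ).prod 𝓘(ℝ, E)) x).symm
      = (extChartAt 𝓘(ℝ, E) x.2).symm ∘ Prod.snd := by
    rw [extChartAt_prod]
    rfl
  refine (mfderiv_comp_mfderivWithin_extChartAt_symm hz mdifferentiableAt_snd).trans ?_
  rw [ModelWithCorners.range_eq_univ, ModelWithCorners.range_eq_univ, mfderivWithin_univ,
    mfderivWithin_univ, hsnd,
    mfderiv_comp (I := 𝓘(ℝ, ℝ × E)) z hchart differentiableAt_snd.mdifferentiableAt,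
    mfderiv_eq_fderiv, fderiv_snd]
  rfl

theorem inChart_staticMetric_eventuallyEq :
    inChart (𝓘(ℝ, ℝ).prod 𝓘(ℝ, E)) (staticMetric J f gF) x
      =ᶠ[nhds (extChartAt (𝓘(ℝ, ℝ).prod 𝓘(ℝ, E)) x x)]
        localStatic (f ∘ (extChartAt 𝓘(ℝ, E) x.2).symm) (inChart 𝓘(ℝ, E) gF x.2) := by
  filter_upwards [extChartAt_target_mem_nhds x] with z hz
  let y := (extChartAt (𝓘(ℝ, ℝ).prod 𝓘(ℝ, E)) x).symm z
  let D := mfderivWithin 𝓘(ℝ, ℝ × E) (𝓘(ℝ, ℝ).prod 𝓘(ℝ, E))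
    (extChartAt (𝓘(ℝ, ℝ).prod 𝓘(ℝ, E)) x).symm (Set.range (𝓘(ℝ, ℝ).prod 𝓘(ℝ, E))) z
  have hpull : inChart (𝓘(ℝ, ℝ).prod 𝓘(ℝ, E)) (staticMetric J f gF) x z
      = -(f ((extChartAt 𝓘(ℝ, E) x.2).symm z.2) ^ 2 •
          pullback (ContinuousLinearMap.mul ℝ ℝ) ((dt J y).comp D))
        + pullback (gF ((extChartAt 𝓘(ℝ, E) x.2).symm z.2))
          ((mfderiv (𝓘(ℝ, ℝ).prod 𝓘(ℝ, E)) 𝓘(ℝ, E) (Prod.snd : J × F → F) y).comp D) := rfl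
  rw [hpull, dt_comp_mfderivWithin_extChartAt_symm hz,
    mfderiv_snd_comp_mfderivWithin_extChartAt_symm hz, ← neg_smul]
  rfl

theorem staticMetric_eq_blockForm :
    staticMetric J f gF x = blockForm (E := E) (-f x.2 ^ 2) (gF x.2) := by
  rw [← inChart_self (g := staticMetric J f gF),
    inChart_staticMetric_eventuallyEq.eq_of_nhds, localStatic, extChartAt_prod]
  exact congrArg₂ blockForm (congr_arg (fun p => -f p ^ 2) (extChartAt_to_inv x.2)) inChart_self

theorem staticMetric_apply (v w : ℝ × E) :
    staticMetric J f gF x v w = -f x.2 ^ 2 * (v.1 * w.1) + gF x.2 v.2 w.2 := by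
  rw [staticMetric_eq_blockForm]
  rfl

theorem staticMetric_one_zero_neg (h₀ : f x.2 ≠ 0) :
    staticMetric J f gF x ((1, 0) : ℝ × E) ((1, 0) : ℝ × E) < 0 := by
  have hspace : gF x.2 (0 : E) (0 : E) = 0 := map_zero _
  rw [staticMetric_apply, hspace, mul_one, mul_one, add_zero]
  exact neg_neg_of_pos (by positivity)

end StaticMetric

section StaticEnergyMomentum

variable {E : Type*} [NormedAddCommGroup E] [NormedSpace ℝ E] [FiniteDimensional ℝ E]
  {F : Type*} [TopologicalSpace F] [ChartedSpace E F] [IsManifold 𝓘(ℝ, E) 3 F]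
  {J : TopologicalSpace.Opens ℝ} {f : F → ℝ}
  {gF : ∀ p : F, TangentSpace 𝓘(ℝ, E) p →L[ℝ] TangentSpace 𝓘(ℝ, E) p →L[ℝ] ℝ} {x : J × F}
  {w : ℝ × E}

theorem smul_energyMomentum_staticMetric (hgF : IsPseudoRiemannianMetric 𝓘(ℝ, E) 2 gF)
    (hf : ContMDiff 𝓘(ℝ, E) 𝓘(ℝ, ℝ) 2 f) (h₀ : f x.2 ≠ 0) :
    (8 * Real.pi) • energyMomentum (𝓘(ℝ, ℝ).prod 𝓘(ℝ, E)) (staticMetric J f gF) x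
      = -((f x.2)⁻¹ •
          pullback (adjointScalar 𝓘(ℝ, E) gF f x.2)
            (mfderiv (𝓘(ℝ, ℝ).prod 𝓘(ℝ, E)) 𝓘(ℝ, E) (Prod.snd : J × F → F) x))
        - (1 / 2 * scalarCurvature 𝓘(ℝ, E) gF x.2) • staticMetric J f gF x := by
  have hfx : (f ∘ (extChartAt 𝓘(ℝ, E) x.2).symm)
      (extChartAt (𝓘(ℝ, ℝ).prod 𝓘(ℝ, E)) x x).2 = f x.2 :=
    congr_arg f (extChartAt_to_inv x.2)
  have hg := inChart_staticMetric_eventuallyEq (f := f) (gF := gF) (x := x)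
  have hlocal := localEinstein_localStatic (z := extChartAt (𝓘(ℝ, ℝ).prod 𝓘(ℝ, E)) x x)
    (hfx.trans_ne h₀) (contDiffAt_comp_extChartAt_symm hf) hgF.isLocalMetric_inChart
  rw [← localEinstein_congr hg, ← hg.eq_of_nhds, ← smul_energyMomentum_eq_localEinstein,
    inChart_self, hfx] at hlocal
  rw [hlocal, adjointScalar_eq_localAdjointScalar, scalarCurvature_eq_localScalarCurvature,
    mfderiv_snd]
  rfl

theorem energyMomentum_staticMetric_apply (hgF : IsPseudoRiemannianMetric 𝓘(ℝ, E) 2 gF)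
    (hf : ContMDiff 𝓘(ℝ, E) 𝓘(ℝ, ℝ) 2 f) (h₀ : f x.2 ≠ 0) (v w : ℝ × E) :
    8 * Real.pi * energyMomentum (𝓘(ℝ, ℝ).prod 𝓘(ℝ, E)) (staticMetric J f gF) x v w
      = -((f x.2)⁻¹ * adjointScalar 𝓘(ℝ, E) gF f x.2 v.2 w.2)
        - 1 / 2 * scalarCurvature 𝓘(ℝ, E) gF x.2 * staticMetric J f gF x v w := by
  have htensor := smul_energyMomentum_staticMetric (J := J) hgF hf h₀
  rw [mfderiv_snd] at htensor
  exact DFunLike.congr_fun (DFunLike.congr_fun htensor v) w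

theorem energyMomentum_staticMetric_nonneg (hgF : IsPseudoRiemannianMetric 𝓘(ℝ, E) 2 gF)
    (hf : ContMDiff 𝓘(ℝ, E) 𝓘(ℝ, ℝ) 2 f) (hpos : 0 < f x.2)
    (hL : adjointScalar 𝓘(ℝ, E) gF f x.2 w.2 w.2 ≤ 0)
    (hτ : 0 ≤ scalarCurvature 𝓘(ℝ, E) gF x.2) (hw : staticMetric J f gF x w w ≤ 0) :
    0 ≤ energyMomentum (𝓘(ℝ, ℝ).prod 𝓘(ℝ, E)) (staticMetric J f gF) x w w := by
  have hspace := mul_nonpos_of_nonneg_of_nonpos (inv_nonneg.2 hpos.le) hL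
  have hcausal := mul_nonpos_of_nonneg_of_nonpos hτ hw
  refine nonneg_of_mul_nonneg_right ?_ (by positivity : 0 < 8 * Real.pi)
  rw [energyMomentum_staticMetric_apply hgF hf hpos.ne']
  linarith

theorem energyMomentum_staticMetric_nonpos (hgF : IsPseudoRiemannianMetric 𝓘(ℝ, E) 2 gF)
    (hf : ContMDiff 𝓘(ℝ, E) 𝓘(ℝ, ℝ) 2 f) (hpos : 0 < f x.2)
    (hL : 0 ≤ adjointScalar 𝓘(ℝ, E) gF f x.2 w.2 w.2)
    (hτ : scalarCurvature 𝓘(ℝ, E) gF x.2 ≤ 0) (hw : staticMetric J f gF x w w ≤ 0) :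
    energyMomentum (𝓘(ℝ, ℝ).prod 𝓘(ℝ, E)) (staticMetric J f gF) x w w ≤ 0 := by
  have hspace := mul_nonneg (inv_nonneg.2 hpos.le) hL
  have hcausal := mul_nonneg_of_nonpos_of_nonpos hτ hw
  refine nonpos_of_mul_nonpos_right ?_ (by positivity : 0 < 8 * Real.pi)
  rw [energyMomentum_staticMetric_apply hgF hf hpos.ne']
  linarith

theorem energyMomentum_staticMetric_of_adjointScalar_eq_zero
    (hgF : IsPseudoRiemannianMetric 𝓘(ℝ, E) 2 gF)
    (hf : ContMDiff 𝓘(ℝ, E) 𝓘(ℝ, ℝ) 2 f) (h₀ : f x.2 ≠ 0)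
    (hL : adjointScalar 𝓘(ℝ, E) gF f x.2 w.2 w.2 = 0) :
    8 * Real.pi * energyMomentum (𝓘(ℝ, ℝ).prod 𝓘(ℝ, E)) (staticMetric J f gF) x w w
      = -(1 / 2) * scalarCurvature 𝓘(ℝ, E) gF x.2 * staticMetric J f gF x w w := by
  rw [energyMomentum_staticMetric_apply hgF hf h₀, hL]
  ring

theorem scalarCurvature_nonneg_of_energyMomentum_one_zero_nonneg
    (hgF : IsPseudoRiemannianMetric 𝓘(ℝ, E) 2 gF) (hf : ContMDiff 𝓘(ℝ, E) 𝓘(ℝ, ℝ) 2 f)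
    (h₀ : f x.2 ≠ 0)
    (hT : 0 ≤ energyMomentum (𝓘(ℝ, ℝ).prod 𝓘(ℝ, E)) (staticMetric J f gF) x
      ((1, 0) : ℝ × E) ((1, 0) : ℝ × E)) :
    0 ≤ scalarCurvature 𝓘(ℝ, E) gF x.2 := by
  have hspace : adjointScalar 𝓘(ℝ, E) gF f x.2 (0 : E) (0 : E) = 0 := map_zero _
  have hvacuum := energyMomentum_staticMetric_of_adjointScalar_eq_zero (J := J) (w := (1, 0))
    hgF hf h₀ hspace
  have htime := staticMetric_one_zero_neg (J := J) (gF := gF) h₀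
  have h8πT := mul_nonneg (by positivity : 0 ≤ 8 * Real.pi) hT
  rw [hvacuum] at h8πT
  nlinarith

end StaticEnergyMomentum

end PseudoRiem

end

theorem mainTheorem8_general
    {E : Type*} [NormedAddCommGroup E] [NormedSpace ℝ E] [FiniteDimensional ℝ E]
    {F : Type*} [TopologicalSpace F] [ChartedSpace E F] [IsManifold 𝓘(ℝ, E) 3 F]
    {gF : ∀ p : F, TangentSpace 𝓘(ℝ, E) p →L[ℝ] TangentSpace 𝓘(ℝ, E) p →L[ℝ] ℝ}
    (hgF : PseudoRiem.IsPseudoRiemannianMetric 𝓘(ℝ, E) 2 gF)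
    {f : F → ℝ} (hf : ContMDiff 𝓘(ℝ, E) 𝓘(ℝ, ℝ) 2 f) (hfpos : ∀ p, 0 < f p)
    {J : TopologicalSpace.Opens ℝ} (hJ : (J : Set ℝ).Nonempty)
    {g : ∀ x : J × F, TangentSpace (𝓘(ℝ, ℝ).prod 𝓘(ℝ, E)) x →L[ℝ]
      TangentSpace (𝓘(ℝ, ℝ).prod 𝓘(ℝ, E)) x →L[ℝ] ℝ}
    (hg : g = PseudoRiem.staticMetric J f gF) :
    ((∀ p v, PseudoRiem.adjointScalar 𝓘(ℝ, E) gF f p v v ≤ 0) →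
      (∀ p, 0 ≤ PseudoRiem.scalarCurvature 𝓘(ℝ, E) gF p) →
      ∀ x w, PseudoRiem.IsCausal (𝓘(ℝ, ℝ).prod 𝓘(ℝ, E)) g x w →
        0 ≤ PseudoRiem.energyMomentum (𝓘(ℝ, ℝ).prod 𝓘(ℝ, E)) g x w w) ∧
    ((∀ p v, 0 ≤ PseudoRiem.adjointScalar 𝓘(ℝ, E) gF f p v v) →
      (∀ p, PseudoRiem.scalarCurvature 𝓘(ℝ, E) gF p ≤ 0) →
      ∀ x w, PseudoRiem.IsCausal (𝓘(ℝ, ℝ).prod 𝓘(ℝ, E)) g x w →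
        PseudoRiem.energyMomentum (𝓘(ℝ, ℝ).prod 𝓘(ℝ, E)) g x w w ≤ 0) ∧
    ((∀ p v, PseudoRiem.adjointScalar 𝓘(ℝ, E) gF f p v v = 0) →
      (∀ x w, 8 * Real.pi * PseudoRiem.energyMomentum (𝓘(ℝ, ℝ).prod 𝓘(ℝ, E)) g x w w =
        -(1 / 2) * PseudoRiem.scalarCurvature 𝓘(ℝ, E) gF x.2 * g x w w) ∧
      ((∀ x w, PseudoRiem.IsCausal (𝓘(ℝ, ℝ).prod 𝓘(ℝ, E)) g x w →
          0 ≤ PseudoRiem.energyMomentum (𝓘(ℝ, ℝ).prod 𝓘(ℝ, E)) g x w w) ↔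
        ∀ p, 0 ≤ PseudoRiem.scalarCurvature 𝓘(ℝ, E) gF p)) := by
  subst hg
  have hnonneg (hL : ∀ p v, PseudoRiem.adjointScalar 𝓘(ℝ, E) gF f p v v ≤ 0)
      (hτ : ∀ p, 0 ≤ PseudoRiem.scalarCurvature 𝓘(ℝ, E) gF p) (x : J × F)
      (w : ℝ × E) (hw : PseudoRiem.IsCausal (𝓘(ℝ, ℝ).prod 𝓘(ℝ, E))
        (PseudoRiem.staticMetric J f gF) x w) :=
    PseudoRiem.energyMomentum_staticMetric_nonneg hgF hf (hfpos x.2) (hL x.2 w.2) (hτ x.2) hw.2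
  refine ⟨hnonneg, fun hL hτ x w hw => ?_, fun hL => ⟨fun x w => ?_, fun hT p => ?_, ?_⟩⟩
  · exact PseudoRiem.energyMomentum_staticMetric_nonpos hgF hf (hfpos x.2) (hL x.2 w.2) (hτ x.2)
      hw.2
  · exact PseudoRiem.energyMomentum_staticMetric_of_adjointScalar_eq_zero hgF hf (hfpos x.2).ne'
      (hL x.2 w.2)
  · obtain ⟨t, ht⟩ := hJ
    let x : J × F := (⟨t, ht⟩, p)
    have htime := PseudoRiem.staticMetric_one_zero_neg (gF := gF) (x := x) (hfpos p).ne'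
    exact PseudoRiem.scalarCurvature_nonneg_of_energyMomentum_one_zero_nonneg (x := x) hgF hf
      (hfpos p).ne' (hT x _ (PseudoRiem.isCausal_of_apply_self_neg htime))
  · exact hnonneg fun p v => (hL p v).le

theorem mainTheorem8
    {E : Type*} [NormedAddCommGroup E] [NormedSpace ℝ E] [FiniteDimensional ℝ E]
    {F : Type*} [TopologicalSpace F] [ChartedSpace E F] [IsManifold 𝓘(ℝ, E) ∞ F]
    (gF : Bundle.ContMDiffRiemannianMetric 𝓘(ℝ, E) ∞ E (fun p : F => TangentSpace 𝓘(ℝ, E) p))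
    (f : F → ℝ) (hf : ContMDiff 𝓘(ℝ, E) 𝓘(ℝ, ℝ) ∞ f) (hfpos : ∀ p, 0 < f p)
    (t₁ t₂ : EReal) (ht : t₁ < t₂)
    (g : ∀ x : PseudoRiem.openInterval t₁ t₂ × F,
      TangentSpace (𝓘(ℝ, ℝ).prod 𝓘(ℝ, E)) x →L[ℝ]
        TangentSpace (𝓘(ℝ, ℝ).prod 𝓘(ℝ, E)) x →L[ℝ] ℝ)
    (hg : g = PseudoRiem.staticMetric (PseudoRiem.openInterval t₁ t₂) f gF.inner) :
    ((∀ p v, PseudoRiem.adjointScalar 𝓘(ℝ, E) gF.inner f p v v ≤ 0) →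
      (∀ p, 0 ≤ PseudoRiem.scalarCurvature 𝓘(ℝ, E) gF.inner p) →
      ∀ x w, PseudoRiem.IsCausal (𝓘(ℝ, ℝ).prod 𝓘(ℝ, E)) g x w →
        0 ≤ PseudoRiem.energyMomentum (𝓘(ℝ, ℝ).prod 𝓘(ℝ, E)) g x w w) ∧
    ((∀ p v, 0 ≤ PseudoRiem.adjointScalar 𝓘(ℝ, E) gF.inner f p v v) →
      (∀ p, PseudoRiem.scalarCurvature 𝓘(ℝ, E) gF.inner p ≤ 0) →
      ∀ x w, PseudoRiem.IsCausal (𝓘(ℝ, ℝ).prod 𝓘(ℝ, E)) g x w →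
        PseudoRiem.energyMomentum (𝓘(ℝ, ℝ).prod 𝓘(ℝ, E)) g x w w ≤ 0) ∧
    ((∀ p v, PseudoRiem.adjointScalar 𝓘(ℝ, E) gF.inner f p v v = 0) →
      (∀ x w, 8 * Real.pi * PseudoRiem.energyMomentum (𝓘(ℝ, ℝ).prod 𝓘(ℝ, E)) g x w w =
        -(1 / 2) * PseudoRiem.scalarCurvature 𝓘(ℝ, E) gF.inner x.2 * g x w w) ∧
      ((∀ x w, PseudoRiem.IsCausal (𝓘(ℝ, ℝ).prod 𝓘(ℝ, E)) g x w →
          0 ≤ PseudoRiem.energyMomentum (𝓘(ℝ, ℝ).prod 𝓘(ℝ, E)) g x w w) ↔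
        ∀ p, 0 ≤ PseudoRiem.scalarCurvature 𝓘(ℝ, E) gF.inner p)) := by
  exact mainTheorem8_general ((PseudoRiem.isPseudoRiemannianMetric_inner gF).of_le ENat.LEInfty.out)
    (hf.of_le ENat.LEInfty.out) hfpos
    (J := PseudoRiem.openInterval t₁ t₂) (EReal.lt_iff_exists_real_btwn.1 ht) hg
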